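/- Let $0<\alpha<1$ and put $r=\sqrt{1-\alpha^2}$. Let $\sigma$ be the measure $d\sigma=\tfrac12\chi_{[-1,1]}(x)\,dx$ on $\mathbb R$, and let $\mathcal M_{\alpha,\sigma}$ be the set of Borel measures $\mu$ on $\mathbb R$ with $0\le\mu\le\sigma$ and $\int d\mu=\alpha$. For $\mu\in\mathcal M_{\alpha,\sigma}$ and $x\in\mathbb R$ let $$U^{\mu}(x)=\int\log\frac1{|x-y|}\,d\mu(y),\qquad J(\mu)=\min_{x\in\operatorname{supp}(\sigma-\mu)}U^{\mu}(x)-\min_{x\in[-1,1]}U^{\mu}(x).$$ Let $\mu_\alpha$ be the measure on $[-1,1]$ with density $$\frac{d\mu_\alpha}{dx}=\begin{cases}\dfrac12,& r\le|x|\le1,\\[2mm]\dfrac1\pi\arctan\left(\dfrac{\alpha}{\sqrt{r^2-x^2}}\right),&|x|<r,\end{cases}$$ and let $$C(\alpha)=\frac{(1+\alpha)\log(1+\alpha)+(1-\alpha)\log(1-\alpha)}2 .$$ Then, for every $\mu\in\mathcal M_{\alpha,\sigma}$, the integral $U^\mu(x)$ converges absolutely for every $x\in\mathbb R$ and both minima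 in the definition of $J(\mu)$ exist. Moreover $\mu_\alpha\in\mathcal M_{\alpha,\sigma}$, and for every $\mu\in\mathcal M_{\alpha,\sigma}$ with $\mu\ne\mu_\alpha$, $$J(\mu)<J(\mu_\alpha)=C(\alpha).$$ In particular $\mu_\alpha$ is the unique maximizer of $J$ over $\mathcal M_{\alpha,\sigma}$. -/

import Mathlib

open MeasureTheory Set

noncomputable section

namespace GridPotential

/-- The measure `dσ = (1/2) χ_{[-1,1]}(x) dx` on the real line, of total mass one. -/
def sigma : Measure ℝ :=
  (2 : ENNReal)⁻¹ • (volume : Measure ℝ).restrict (Icc (-1) 1)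

/-- The class of (positive) measures `μ` of total mass `α` with `0 ≤ μ ≤ σ`. -/
def constrainedMeasures (α : ℝ) : Set (Measure ℝ) :=
  {μ | μ univ = ENNReal.ofReal α ∧ μ ≤ sigma}

/-- The integrand `y ↦ log (1 / |x - y|)` of the logarithmic potential. Its value at `y = x` is
immaterial for measures without atoms, in particular for all measures `μ ≤ σ`. -/
def logKernel (x y : ℝ) : ℝ := Real.log (1 / |x - y|)

/-- The logarithmic potential `U^μ(x) = ∫ log (1 / |x - y|) dμ(y)`, at real points `x`. -/
def logPotential (μ : Measure ℝ) (x : ℝ) : ℝ := ∫ y, logKernel x y ∂μ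

/-- The infimum of `f` over `s`; it is the minimum whenever `f` attains one on `s`. -/
def minOver (f : ℝ → ℝ) (s : Set ℝ) : ℝ := sInf (f '' s)

/-- `J(μ) = min_{supp(σ - μ)} U^μ - min_{[-1,1]} U^μ`. -/
def J (μ : Measure ℝ) : ℝ :=
  minOver (logPotential μ) (sigma - μ).support - minOver (logPotential μ) (Icc (-1) 1)

/-- `r(α) = √(1 - α²)`. -/
def radius (α : ℝ) : ℝ := √(1 - α ^ 2)

/-- The density of `μ_α`: `1/2` on `[-1,-r] ∪ [r,1]`,
`(1/π) arctan (α / √(r² - x²))` on `(-r,r)`, and `0` outside `[-1,1]`. -/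
def muAlphaDensity (α x : ℝ) : ℝ :=
  if |x| < radius α then
    1 / Real.pi * Real.arctan (α / √(radius α ^ 2 - x ^ 2))
  else if |x| ≤ 1 then 1 / 2
  else 0

/-- The constrained equilibrium measure `μ_α`, given by its density. -/
def muAlpha (α : ℝ) : Measure ℝ :=
  (volume : Measure ℝ).withDensity fun x => ENNReal.ofReal (muAlphaDensity α x)

/-- `C(α) = ((1+α) log (1+α) + (1-α) log (1-α)) / 2`. -/
def C (α : ℝ) : ℝ :=
  ((1 + α) * Real.log (1 + α) + (1 - α) * Real.log (1 - α)) / 2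

end GridPotential

end

open MeasureTheory Set

noncomputable section

namespace GridPotential

open Filter Topology Real

/-! ### A minimum principle for superharmonic functions -/

/-! The measure `muAlpha α` is an average over `t ∈ (0, α)` of arcsine laws on `[-√(1 - t²), √(1 -
t²)]` (`muAlpha_eq_map`). The Joukowski substitution gives each arcsine potential in closed form
(`arcsinePotential_eq`): it is constant and maximal on its interval, and on `[-1, 1]` it is least at
the endpoint `1`. All these intervals contain `[-r, r]`, so the averaged potential is maximal and
constant on `[-r, r]`, which contains the support of `sigma - muAlpha α`, and is least on `[-1, 1]`
at `1`. The gap between these two values is an elementary integral in `t`, equal to `C α`.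

For a competitor `μ` let `m` and `n` be its two minima and put `D = U^μ - U^{μ_α} + U^{μ_α}(0) - m`
on `ℂ`. On the support of `sigma - μ` one has `D ≥ 0`. Off that support `μ` coincides locally with
`sigma`, hence dominates `muAlpha α`, and `D` is superharmonic. The masses agree, so `D` has a
finite limit at infinity, and a minimum principle gives `D ≥ 0` everywhere
(`nonneg_of_nonneg_on_support`). At a point where `U^μ` attains `n` this reads `m - n ≤ C α`.

If equality held, `D` would vanish at that point, which lies off the support because `C α > 0`. The
zero then spreads over the plane (`eq_zero_of_superharmonic`), and a measure is determined by its
potential (`eq_of_cpot_sub_eq`).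

Superharmonicity is used only as an inequality for circle averages, which are explicit for
logarithmic kernels. -/

theorem eq_of_circleAverage_le {D : ℂ → ℝ} (hD : Continuous D) {z : ℂ} {m R : ℝ}
    (hm : ∀ w, m ≤ D w) (h : circleAverage D z R ≤ m) (θ : ℝ) :
    D (circleMap z R θ) = m := by
  by_contra hne
  have hper : Function.Periodic (fun t => D (circleMap z R t)) (2 * π) := fun t => by
    simp [periodic_circleMap z R t]
  obtain ⟨t, ht, hte⟩ := hper.exists_mem_Ico₀ two_pi_pos θ
  have hpos : 0 < ∫ s in (0 : ℝ)..2 * π, (D (circleMap z R s) - m) := by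
    refine intervalIntegral.integral_pos two_pi_pos ?_ (fun s _ => sub_nonneg.2 (hm _))
      ⟨t, ⟨ht.1, ht.2.le⟩, ?_⟩
    · fun_prop
    · have : D (circleMap z R θ) = D (circleMap z R t) := hte
      rw [← this]
      exact sub_pos.2 (lt_of_le_of_ne (hm _) (Ne.symm hne))
  rw [intervalIntegral.integral_sub
    ((by fun_prop : Continuous fun s => D (circleMap z R s)).intervalIntegrable _ _)
    intervalIntegrable_const, intervalIntegral.integral_const] at hpos
  rw [circleAverage_def, smul_eq_mul, inv_mul_le_iff₀ two_pi_pos] at h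
  simp only [sub_zero, smul_eq_mul] at hpos
  linarith

/-- Each point of the ball lies on a circle centred at `z`, and on that circle the average cannot
exceed the minimum `m`. -/
theorem eq_on_ball_of_superharmonic {D : ℂ → ℝ} (hD : Continuous D) {z : ℂ} {m ε : ℝ}
    (hm : ∀ w, m ≤ D w) (hz : D z = m)
    (h : ∀ R ∈ Ioo 0 ε, circleAverage D z R ≤ D z) {w : ℂ} (hw : dist w z < ε) : D w = m := by
  rcases eq_or_ne w z with rfl | hne
  · exact hz
  have hmem : w ∈ range (circleMap z (dist w z)) := by
    rw [range_circleMap]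
    simp [dist_eq_norm]
  obtain ⟨θ, hθ⟩ := hmem
  rw [← hθ]
  exact eq_of_circleAverage_le hD hm ((h _ ⟨dist_pos.2 hne, hw⟩).trans hz.le) θ

/-- Minimum principle on the complement of `S`, including infinity. The hypothesis that one circle
average equals the limit `c` takes the place of superharmonicity at infinity. -/
theorem nonneg_of_superharmonic {D : ℂ → ℝ} (hD : Continuous D) {S : Set ℂ} (hS : S.Nonempty)
    (hDS : ∀ z ∈ S, 0 ≤ D z)
    (h : ∀ z ∉ S, ∃ ε > 0, ∀ R ∈ Ioo 0 ε, circleAverage D z R ≤ D z)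
    {c : ℝ} (hc : Tendsto D (cocompact ℂ) (𝓝 c)) {ρ : ℝ} (hρ : circleAverage D 0 ρ = c) (z : ℂ) :
    0 ≤ D z := by
  by_contra! hz
  obtain ⟨z₁, hz₁⟩ : ∃ z₁, ∀ w, D z₁ ≤ D w := by
    -- Either `c` is a lower bound, and then it is attained on the circle of radius `ρ`, or `D`
    -- takes a value below its limit and so attains its minimum.
    by_cases hcD : ∀ w, c ≤ D w
    · exact ⟨circleMap 0 ρ 0, fun w => (eq_of_circleAverage_le hD hcD hρ.le 0).trans_le (hcD w)⟩
    · push Not at hcD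
      obtain ⟨w, hw⟩ := hcD
      exact hD.exists_forall_le' w ((hc.eventually_const_lt hw).mono fun _ hx => le_of_lt hx)
  obtain ⟨s, hs⟩ := hS
  have hcl : IsClosed {w | D w = D z₁} := isClosed_eq hD continuous_const
  -- Take the minimizer `w` nearest to a point `s` of `S`. As `D` is constant near `w`, a small move
  -- towards `s` gives a nearer minimizer, so no connectedness argument is needed.
  obtain ⟨w, hw, hws⟩ := hcl.exists_infDist_eq_dist ⟨z₁, rfl⟩ s
  have hneg : ∀ w, D w = D z₁ → w ∉ S := fun w hw hwS => by
    have := hDS w hwS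
    have := hz₁ z
    linarith
  obtain ⟨ε, hε, hR⟩ := h w (hneg w hw)
  have hne : s ≠ w := fun he => hneg w hw (he ▸ hs)
  have hd : 0 < dist s w := dist_pos.2 hne
  have hd' : ‖s - w‖ = dist s w := (dist_eq_norm s w).symm
  obtain ⟨t, ht0, ht1, htε⟩ : ∃ t : ℝ, 0 < t ∧ t < 1 ∧ t * dist s w < ε := by
    refine ⟨min (1 / 2) (ε / (2 * dist s w)), by positivity,
      (min_le_left _ _).trans_lt (by norm_num), ?_⟩
    calc _ ≤ ε / (2 * dist s w) * dist s w := by gcongr; exact min_le_right _ _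
      _ = ε / 2 := by field_simp
      _ < ε := by linarith
  have h1 : dist (w + t * (s - w)) w < ε := by
    rw [dist_eq_norm, add_sub_cancel_left, norm_mul, hd', Complex.norm_real, norm_of_nonneg ht0.le]
    exact htε
  have h2 := eq_on_ball_of_superharmonic hD hz₁ hw hR h1
  have h3 : Metric.infDist s {w | D w = D z₁} ≤ dist s (w + t * (s - w)) :=
    Metric.infDist_le_dist_of_mem h2
  have h4 : dist s (w + t * (s - w)) = (1 - t) * dist s w := by
    rw [dist_eq_norm, show s - (w + t * (s - w)) = ((1 - t : ℝ) : ℂ) * (s - w) by push_cast; ring,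
      norm_mul, hd', Complex.norm_real, norm_of_nonneg (by linarith)]
  rw [hws, h4] at h3
  nlinarith

theorem eq_zero_of_superharmonic {D : ℂ → ℝ} (hD : Continuous D) {S : Set ℂ}
    (hSre : ∀ z ∈ S, z.im = 0) (hnn : ∀ z, 0 ≤ D z)
    (h : ∀ z ∉ S, ∃ ε > 0, ∀ R ∈ Ioo 0 ε, circleAverage D z R ≤ D z)
    {x : ℝ} (hxS : (x : ℂ) ∉ S) (hx : D x = 0) {z : ℂ} (hz : 0 ≤ z.im) : D z = 0 := by
  have hint : ∀ w, D w = 0 → w ∉ S → w ∈ interior {w | D w = 0} := fun w hw hwS => by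
    obtain ⟨ε, hε, hR⟩ := h w hwS
    refine mem_interior_iff_mem_nhds.2 (mem_of_superset (Metric.ball_mem_nhds w hε) ?_)
    exact fun v hv => eq_on_ball_of_superharmonic hD hnn hw hR hv
  have hsub : {z : ℂ | 0 < z.im} ⊆ interior {w | D w = 0} := by
    -- The open half-plane is connected and misses `S`, so the interior of the zero set is
    -- relatively clopen in it. A ball about the real point `x` supplies a starting point.
    refine (convex_halfSpace_im_gt 0).isPreconnected.subset_of_closure_inter_subset isOpen_interior
      ?_ ?_
    · have hxi : interior {w | D w = 0} ∈ 𝓝 (x : ℂ) := isOpen_interior.mem_nhds (hint x hx hxS)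
      obtain ⟨ε, hε, hb⟩ := Metric.mem_nhds_iff.1 hxi
      refine ⟨x + (ε / 2 : ℝ) * Complex.I, by simpa using hε, hb ?_⟩
      simp [abs_of_pos hε, hε]
    · rintro w ⟨hw, hwi⟩
      refine hint w ?_ fun hwS => (ne_of_gt hwi) (hSre w hwS)
      exact (closure_minimal interior_subset (isClosed_eq hD continuous_const)) hw
  have hcl : closure {z : ℂ | 0 < z.im} ⊆ {w | D w = 0} :=
    closure_minimal (hsub.trans interior_subset) (isClosed_eq hD continuous_const)
  rw [Complex.closure_setOfPred_lt_im] at hcl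
  exact hcl hz

/-! ### Measures dominated by `sigma` -/

theorem sigma_univ : sigma univ = 1 := by
  simp only [sigma, Measure.smul_apply, Measure.restrict_apply_univ, Real.volume_Icc, smul_eq_mul]
  norm_num
  exact ENNReal.inv_mul_cancel (by norm_num) (by norm_num)

instance : IsProbabilityMeasure sigma := ⟨sigma_univ⟩

instance : NullSingletonClass sigma := by
  refine ⟨fun x => ?_⟩
  simp [sigma]

theorem ae_sigma_mem : ∀ᵐ y ∂sigma, y ∈ Icc (-1 : ℝ) 1 := by
  unfold sigma
  exact Measure.ae_smul_measure (ae_restrict_mem measurableSet_Icc) _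

theorem ae_abs_le {μ : Measure ℝ} (hμ : μ ≤ sigma) : ∀ᵐ y ∂μ, |y| ≤ 1 :=
  (Measure.absolutelyContinuous_of_le hμ).ae_le (ae_sigma_mem.mono fun _ hy => abs_le.2 hy)

theorem ae_ne {μ : Measure ℝ} (hμ : μ ≤ sigma) (x : ℝ) : ∀ᵐ y ∂μ, y ≠ x :=
  (Measure.absolutelyContinuous_of_le hμ).ae_le (Measure.ae_ne sigma x)

theorem isFiniteMeasure_of_le_sigma {μ : Measure ℝ} (hμ : μ ≤ sigma) : IsFiniteMeasure μ :=
  isFiniteMeasure_of_le sigma hμ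

theorem integral_sigma_eq (f : ℝ → ℝ) : ∫ y, f y ∂sigma = 2⁻¹ * ∫ y in Icc (-1) 1, f y := by
  simp [sigma, integral_smul_measure]

theorem integrable_sigma_of_integrableOn {f : ℝ → ℝ} (hf : IntegrableOn f (Icc (-1) 1)) :
    Integrable f sigma :=
  Integrable.smul_measure hf (by norm_num)

theorem integrable_log_sub {μ : Measure ℝ} (hμ : μ ≤ sigma) (x : ℝ) :
    Integrable (fun y => log (x - y)) μ := by
  refine Integrable.mono_measure (integrable_sigma_of_integrableOn ?_) hμ
  have h := (intervalIntegral.intervalIntegrable_log' (a := x - -1) (b := x - 1)).comp_sub_left x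
  rw [intervalIntegrable_iff_integrableOn_Icc_of_le (by simp)] at h
  simpa using h

theorem integrable_logKernel {μ : Measure ℝ} (hμ : μ ≤ sigma) (x : ℝ) :
    Integrable (logKernel x) μ := by
  have : logKernel x = fun y => -log (x - y) := by
    ext y; simp [logKernel]
  rw [this]
  exact (integrable_log_sub hμ x).neg

theorem abs_re_sub_le (z : ℂ) (y : ℝ) : |z.re - y| ≤ ‖z - y‖ := by
  simpa using Complex.abs_re_le_norm (z - y)

/-- Moving `z` onto the real axis only worsens the singularity, and at distance at least `1` the
logarithm grows at most linearly. -/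
theorem abs_log_norm_sub_le {z : ℂ} {y : ℝ} (h : y ≠ z.re) :
    |log ‖z - y‖| ≤ |log (z.re - y)| + (‖z‖ + |y|) := by
  have h0 : 0 < |z.re - y| := abs_pos.2 (sub_ne_zero.2 h.symm)
  have h1 := abs_re_sub_le z y
  have h2 : ‖z - y‖ ≤ ‖z‖ + |y| := by simpa using norm_sub_le z (y : ℂ)
  rcases le_total ‖z - y‖ 1 with h3 | h3
  · have h4 : log |z.re - y| ≤ log ‖z - y‖ := log_le_log h0 h1
    rw [abs_of_nonpos (log_nonpos (norm_nonneg _) h3)]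
    rw [log_abs] at h4
    have := neg_abs_le (log (z.re - y))
    have := norm_nonneg (z - y)
    linarith
  · rw [abs_of_nonneg (log_nonneg h3)]
    have := log_le_sub_one_of_pos (h0.trans_le h1)
    have := abs_nonneg (log (z.re - y))
    linarith

theorem measurable_log_norm_sub (z : ℂ) : Measurable fun y : ℝ => log ‖z - y‖ := by fun_prop

theorem integrable_log_norm_sub {μ : Measure ℝ} (hμ : μ ≤ sigma) (z : ℂ) :
    Integrable (fun y : ℝ => log ‖z - y‖) μ := by
  have := isFiniteMeasure_of_le_sigma hμ
  refine Integrable.mono' ((integrable_log_sub hμ z.re).abs.add (integrable_const (‖z‖ + 1)))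
    (measurable_log_norm_sub z).aestronglyMeasurable ?_
  filter_upwards [ae_ne hμ z.re, ae_abs_le hμ] with y hy hy1
  exact (abs_log_norm_sub_le hy).trans (by simpa using hy1)

/-! ### The potential in the complex plane and its circle averages -/

/-- The logarithmic potential of a measure on the real line, at complex points. -/
def cpot (μ : Measure ℝ) (z : ℂ) : ℝ := ∫ y, -log ‖z - y‖ ∂μ

/-- The circle average of `log ‖· - y‖` over the circle with centre `z` and radius `R`. -/
def logMax (R : ℝ) (z : ℂ) (y : ℝ) : ℝ := log R + log⁺ (R⁻¹ * ‖z - y‖)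

theorem cpot_ofReal (μ : Measure ℝ) (x : ℝ) : cpot μ x = logPotential μ x := by
  unfold cpot logPotential logKernel
  congr with y
  rw [← Complex.ofReal_sub, Complex.norm_real, one_div, log_inv, norm_eq_abs]

theorem cpot_conj (μ : Measure ℝ) (z : ℂ) : cpot μ (starRingEnd ℂ z) = cpot μ z := by
  unfold cpot
  congr with y
  rw [← Complex.norm_conj]
  simp

theorem circleAverage_log_norm_sub {R : ℝ} (hR : 0 < R) (z : ℂ) (y : ℝ) :
    circleAverage (fun w => log ‖w - y‖) z R = logMax R z y :=
  circleAverage_log_norm_sub_const_eq_log_radius_add_posLog hR.ne'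

theorem continuous_logMax (R : ℝ) : Continuous fun p : ℂ × ℝ => logMax R p.1 p.2 := by
  unfold logMax
  exact continuous_const.add (continuous_posLog.comp (by fun_prop))

theorem posLog_le_self {x : ℝ} (hx : 0 ≤ x) : log⁺ x ≤ x := by
  rcases hx.eq_or_lt with rfl | hx
  · simp
  · exact max_le hx.le ((log_le_sub_one_of_pos hx).trans (by linarith))

theorem abs_logMax_le {R : ℝ} (hR : 0 < R) (z : ℂ) (y : ℝ) :
    |logMax R z y| ≤ |log R| + R⁻¹ * (‖z‖ + |y|) := by
  refine (abs_add_le _ _).trans (add_le_add_right ?_ _)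
  rw [abs_of_nonneg posLog_nonneg]
  refine (posLog_le_self (by positivity)).trans ?_
  gcongr
  simpa using norm_sub_le z (y : ℂ)

theorem integrable_logMax {μ : Measure ℝ} (hμ : μ ≤ sigma) {R : ℝ} (hR : 0 < R) (z : ℂ) :
    Integrable (logMax R z) μ := by
  have := isFiniteMeasure_of_le_sigma hμ
  refine Integrable.mono' (integrable_const (|log R| + R⁻¹ * (‖z‖ + 1)))
    ((continuous_logMax R).comp (Continuous.prodMk_right z)).aestronglyMeasurable ?_
  filter_upwards [ae_abs_le hμ] with y hy
  exact (abs_logMax_le hR z y).trans (by gcongr)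

theorem logMax_of_le {R : ℝ} (hR : 0 < R) {z : ℂ} {y : ℝ} (h : ‖z - y‖ ≤ R) :
    logMax R z y = log R := by
  rw [logMax, add_eq_left, posLog_eq_zero_iff, abs_of_nonneg (by positivity), inv_mul_le_one₀ hR]
  exact h

theorem logMax_of_ge {R : ℝ} (hR : 0 < R) {z : ℂ} {y : ℝ} (h : R ≤ ‖z - y‖) :
    logMax R z y = log ‖z - y‖ := by
  have h0 := hR.trans_le h
  rw [logMax, posLog_eq_log, log_mul (by positivity) (by positivity), log_inv]
  · ring
  · rw [abs_of_nonneg (by positivity), ← div_eq_inv_mul, one_le_div hR]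
    exact h

theorem log_le_logMax {R : ℝ} (hR : 0 < R) {z : ℂ} {y : ℝ} (h0 : 0 < ‖z - y‖) :
    log ‖z - y‖ ≤ logMax R z y := by
  rcases le_total ‖z - y‖ R with h | h
  · rw [logMax_of_le hR h]
    exact log_le_log h0 h
  · rw [logMax_of_ge hR h]

theorem norm_sub_pos {z : ℂ} {y : ℝ} (h : y ≠ z.re) : 0 < ‖z - y‖ :=
  (abs_pos.2 (sub_ne_zero.2 h.symm)).trans_le (abs_re_sub_le z y)

/-- Since `|u| = 2u⁺ - u`, a bound for the absolute value follows from an upper bound for `log⁺` and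
the known average of `log`, which is at least `log R`. This is the integrability that Fubini needs
in `circleAverage_cpot`. -/
theorem circleAverage_abs_log_norm_sub_le {R : ℝ} (hR : 0 < R) (z : ℂ) (y : ℝ) :
    circleAverage (fun w => |log ‖w - y‖|) z R ≤ 2 * (‖z‖ + R + |y|) + |log R| := by
  have h1 : CircleIntegrable (fun w : ℂ => log ‖w - y‖) z R :=
    circleIntegrable_log_norm_sub_const R
  have h2 : CircleIntegrable (fun _ : ℂ => 2 * (‖z‖ + R + |y|)) z R := circleIntegrable_const _ _ _
  have h3 : circleAverage (fun w => |log ‖w - y‖|) z R ≤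
      circleAverage (fun w => 2 * (‖z‖ + R + |y|) - log ‖w - y‖) z R := by
    refine circleAverage_mono h1.abs (h2.sub h1) fun w hw => ?_
    have hw' : ‖w‖ ≤ ‖z‖ + R := by
      have : ‖w - z‖ = R := by
        rw [← dist_eq_norm, Metric.mem_sphere.1 hw, abs_of_pos hR]
      calc ‖w‖ = ‖z + (w - z)‖ := by ring_nf
        _ ≤ _ := (norm_add_le _ _).trans (by rw [this])
    have h4 : ‖w - y‖ ≤ ‖w‖ + |y| := by simpa using norm_sub_le w (y : ℂ)
    have h5 : log⁺ ‖w - y‖ ≤ ‖w - y‖ := posLog_le_self (norm_nonneg _)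
    have h6 : log ‖w - y‖ ≤ log⁺ ‖w - y‖ := le_max_right _ _
    have h7 : 0 ≤ log⁺ ‖w - y‖ := posLog_nonneg
    rw [abs_le]
    constructor
    · linarith [abs_nonneg y, norm_nonneg z]
    · linarith
  rw [circleAverage_fun_sub h2 h1, circleAverage_const, circleAverage_log_norm_sub hR] at h3
  have h8 : log R ≤ logMax R z y := le_add_of_nonneg_right posLog_nonneg
  linarith [neg_abs_le (log R)]

theorem circleAverage_cpot {μ : Measure ℝ} (hμ : μ ≤ sigma) {R : ℝ} (hR : 0 < R) (z : ℂ) :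
    circleAverage (cpot μ) z R = -∫ y, logMax R z y ∂μ := by
  have := isFiniteMeasure_of_le_sigma hμ
  have hint : Integrable (fun p : ℝ × ℝ => -log ‖circleMap z R p.1 - p.2‖)
      ((volume.restrict (Ioc 0 (2 * π))).prod μ) := by
    have hm : Measurable fun p : ℝ × ℝ => -log ‖circleMap z R p.1 - p.2‖ := by
      have := (continuous_circleMap z R).measurable
      fun_prop
    rw [integrable_prod_iff' hm.aestronglyMeasurable]
    constructor
    · refine Eventually.of_forall fun y => ?_
      have h1 : CircleIntegrable (fun w : ℂ => log ‖w - y‖) z R :=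
        circleIntegrable_log_norm_sub_const R
      have h2 := h1.neg
      rw [CircleIntegrable, intervalIntegrable_iff_integrableOn_Ioc_of_le two_pi_pos.le] at h2
      exact h2
    · refine Integrable.mono' (integrable_const (2 * π * (2 * (‖z‖ + R + 1) + |log R|)))
        hm.aestronglyMeasurable.norm.prod_swap.integral_prod_right' ?_
      filter_upwards [ae_abs_le hμ] with y hy
      rw [norm_of_nonneg (integral_nonneg fun _ => norm_nonneg _)]
      have h1 := circleAverage_abs_log_norm_sub_le hR z y
      rw [circleAverage_def, smul_eq_mul, inv_mul_le_iff₀ two_pi_pos,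
        intervalIntegral.integral_of_le two_pi_pos.le] at h1
      simp only [norm_neg, norm_eq_abs]
      refine h1.trans ?_
      gcongr
  rw [circleAverage_def, intervalIntegral.integral_of_le two_pi_pos.le]
  unfold cpot
  rw [integral_integral_swap hint, ← integral_smul, ← integral_neg]
  congr with y
  rw [← circleAverage_log_norm_sub hR, integral_neg, smul_neg, circleAverage_def,
    intervalIntegral.integral_of_le two_pi_pos.le]

/-! ### Continuity and behaviour at infinity -/

theorem continuous_integral_logMax {μ : Measure ℝ} (hμ : μ ≤ sigma) {R : ℝ} (hR : 0 < R) :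
    Continuous fun z => ∫ y, logMax R z y ∂μ := by
  have := isFiniteMeasure_of_le_sigma hμ
  refine continuous_iff_continuousAt.2 fun z₀ => ?_
  refine continuousAt_of_dominated (bound := fun _ => |log R| + R⁻¹ * (‖z₀‖ + 1 + 1))
    (Eventually.of_forall fun z => (integrable_logMax hμ hR z).aestronglyMeasurable) ?_
    (integrable_const _) (Eventually.of_forall fun y =>
      ((continuous_logMax R).comp (Continuous.prodMk_left y)).continuousAt)
  filter_upwards [continuous_norm.continuousAt.eventually_le_const (lt_add_one ‖z₀‖)] with z hz
  filter_upwards [ae_abs_le hμ] with y hy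
  refine (abs_logMax_le hR z y).trans ?_
  gcongr

theorem integral_log_sub_log_near {ε : ℝ} (hε : 0 < ε) :
    IntegrableOn (fun u => log ε - log u) (Icc (-ε) ε) ∧
      ∫ u in Icc (-ε) ε, (log ε - log u) = 2 * ε := by
  have h : -ε ≤ ε := by linarith
  have hi : IntervalIntegrable (fun u => log ε - log u) volume (-ε) ε :=
    intervalIntegrable_const.sub intervalIntegral.intervalIntegrable_log'
  refine ⟨(intervalIntegrable_iff_integrableOn_Icc_of_le h).1 hi, ?_⟩
  rw [integral_Icc_eq_integral_Ioc, ← intervalIntegral.integral_of_le h,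
    intervalIntegral.integral_sub intervalIntegrable_const intervalIntegral.intervalIntegrable_log',
    integral_log, intervalIntegral.integral_const, log_neg_eq_log, smul_eq_mul]
  ring

/-- The integrand is nonnegative and vanishes for `‖z - y‖ ≥ ε`. Passing to `sigma` and projecting
`z` to the real axis increase the integral, and density `1/2` times `2ε` gives `ε`. Uniformity in
`z` makes `cpot` a uniform limit of continuous functions. -/
theorem integral_logMax_sub_log_mem {μ : Measure ℝ} (hμ : μ ≤ sigma) {ε : ℝ} (hε : 0 < ε) (z : ℂ) :
    ∫ y, (logMax ε z y - log ‖z - y‖) ∂μ ∈ Icc 0 ε := by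
  have hnn : ∀ {ν : Measure ℝ}, ν ≤ sigma → ∀ᵐ y ∂ν, 0 ≤ logMax ε z y - log ‖z - y‖ := fun hν => by
    filter_upwards [ae_ne hν z.re] with y hy
    exact sub_nonneg.2 (log_le_logMax hε (norm_sub_pos hy))
  refine ⟨integral_nonneg_of_ae (hnn hμ), ?_⟩
  have hσ := (integrable_logMax le_rfl hε z).sub (integrable_log_norm_sub le_rfl z)
  obtain ⟨hg, hg'⟩ := integral_log_sub_log_near hε
  set g : ℝ → ℝ := (Icc (-ε) ε).indicator fun u => log ε - log u with hgdef
  have hgi : Integrable g := hg.integrable_indicator measurableSet_Icc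
  have hgi' : Integrable fun y => g (z.re - y) := hgi.comp_sub_left z.re
  have hg0 : ∀ u, u ≠ 0 → 0 ≤ g u := fun u h => by
    refine indicator_apply_nonneg fun hu => ?_
    rw [← log_abs u]
    exact sub_nonneg.2 (log_le_log (abs_pos.2 h) (abs_le.2 hu))
  calc _ ≤ ∫ y, (logMax ε z y - log ‖z - y‖) ∂sigma := integral_mono_measure hμ (hnn le_rfl) hσ
    _ ≤ ∫ y, g (z.re - y) ∂sigma := by
      refine integral_mono_ae hσ (integrable_sigma_of_integrableOn hgi'.integrableOn) ?_
      filter_upwards [ae_ne le_rfl z.re] with y hy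
      have h0 : 0 < |z.re - y| := abs_pos.2 (sub_ne_zero.2 hy.symm)
      have h1 := abs_re_sub_le z y
      rcases le_total ‖z - y‖ ε with h | h
      · have : z.re - y ∈ Icc (-ε) ε := abs_le.1 (h1.trans h)
        simp only [hgdef, indicator_of_mem this, logMax_of_le hε h]
        rw [← log_abs (z.re - y)]
        linarith [log_le_log h0 h1]
      · simp only [logMax_of_ge hε h, sub_self]
        exact hg0 _ (sub_ne_zero.2 hy.symm)
    _ ≤ 2⁻¹ * ∫ y, g (z.re - y) := by
      rw [integral_sigma_eq]
      refine mul_le_mul_of_nonneg_left (setIntegral_le_integral hgi' ?_) (by norm_num)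
      filter_upwards [Measure.ae_ne volume z.re] with y hy
      exact hg0 _ (sub_ne_zero.2 hy.symm)
    _ = ε := by
      rw [integral_sub_left_eq_self g volume z.re, hgdef, integral_indicator measurableSet_Icc, hg']
      ring

theorem continuous_cpot {μ : Measure ℝ} (hμ : μ ≤ sigma) : Continuous (cpot μ) := by
  refine continuous_of_uniform_approx_of_continuous fun u hu => ?_
  obtain ⟨ε, hε, hu⟩ := Metric.mem_uniformity_dist.1 hu
  refine ⟨fun z => -∫ y, logMax (ε / 2) z y ∂μ, (continuous_integral_logMax hμ (by positivity)).neg,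
    fun z => hu ?_⟩
  have h := integral_logMax_sub_log_mem hμ (half_pos hε) z
  rw [integral_sub (integrable_logMax hμ (half_pos hε) z) (integrable_log_norm_sub hμ z)] at h
  rw [cpot, integral_neg, Real.dist_eq, abs_lt]
  constructor <;> linarith [h.1, h.2]

theorem tendsto_cpot_add {μ : Measure ℝ} (hμ : μ ≤ sigma) :
    Tendsto (fun z => cpot μ z + μ.real univ * log ‖z‖) (cocompact ℂ) (𝓝 0) := by
  have := isFiniteMeasure_of_le_sigma hμ
  have hlim : Tendsto (fun z : ℂ => (‖z‖ - 1)⁻¹ * μ.real univ) (cocompact ℂ) (𝓝 0) := by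
    have := ((tendsto_atTop_add_const_right _ (-1)
      (tendsto_norm_cocompact_atTop (E := ℂ))).inv_tendsto_atTop).mul_const (μ.real univ)
    simpa [sub_eq_add_neg] using this
  refine squeeze_zero_norm' ?_ hlim
  filter_upwards [tendsto_norm_cocompact_atTop.eventually_ge_atTop 2] with z hz
  have h1 : cpot μ z + μ.real univ * log ‖z‖ = ∫ y, (log ‖z‖ - log ‖z - y‖) ∂μ := by
    rw [integral_sub (integrable_const _) (integrable_log_norm_sub hμ z), cpot, integral_neg,
      integral_const, smul_eq_mul]
    ring
  rw [h1]
  refine norm_integral_le_of_norm_le_const ?_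
  filter_upwards [ae_abs_le hμ] with y hy
  have hz0 : 0 < ‖z‖ := by linarith
  have h2 : ‖z - y‖ ≤ ‖z‖ + |y| := by simpa using norm_sub_le z (y : ℂ)
  have h3 : ‖z‖ - |y| ≤ ‖z - y‖ := by simpa using norm_sub_norm_le z (y : ℂ)
  have h4 : 0 < ‖z - y‖ := by linarith
  have h5 : 0 < ‖z‖ - 1 := by linarith
  -- Both signs of `log ‖z‖ - log ‖z - y‖` are handled at once by `log (b / a) ≤ b / a - 1 ≤ 1 / a`.
  have key : ∀ a b : ℝ, ‖z‖ - 1 ≤ a → 0 < b → b ≤ a + 1 → log b - log a ≤ (‖z‖ - 1)⁻¹ := by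
    intro a b ha hb hab
    have ha0 : 0 < a := by linarith
    rw [← log_div hb.ne' ha0.ne']
    refine (log_le_sub_one_of_pos (by positivity)).trans ?_
    calc b / a - 1 ≤ (a + 1) / a - 1 := by gcongr
      _ = a⁻¹ := by field_simp; ring
      _ ≤ _ := by gcongr
  rw [norm_eq_abs, abs_le]
  constructor
  · linarith [key ‖z‖ ‖z - y‖ (by linarith) h4 (by linarith)]
  · exact key ‖z - y‖ ‖z‖ (by linarith) hz0 (by linarith)

/-- The radius `2` encloses `[-1, 1]`, so the average depends on the total mass only. For two
measures of equal mass it cancels, which gives the circle required by `nonneg_of_superharmonic`. -/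
theorem circleAverage_cpot_zero_two {μ : Measure ℝ} (hμ : μ ≤ sigma) :
    circleAverage (cpot μ) 0 2 = -(μ.real univ * log 2) := by
  have := isFiniteMeasure_of_le_sigma hμ
  rw [circleAverage_cpot hμ two_pos, integral_congr_ae (g := fun _ => log 2), integral_const,
    smul_eq_mul]
  filter_upwards [ae_abs_le hμ] with y hy
  refine logMax_of_le two_pos ?_
  simp only [zero_sub, norm_neg, Complex.norm_real, norm_eq_abs]
  linarith

/-! ### Domination principle -/

theorem sigma_sub_add {μ : Measure ℝ} (hμ : μ ≤ sigma) : sigma - μ + μ = sigma := by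
  have := isFiniteMeasure_of_le_sigma hμ
  exact Measure.sub_add_cancel_of_le hμ

theorem cpot_sub_circleAverage {μ : Measure ℝ} (hμ : μ ≤ sigma) {R : ℝ} (hR : 0 < R) (z : ℂ) :
    cpot μ z - circleAverage (cpot μ) z R = ∫ y, (logMax R z y - log ‖z - y‖) ∂μ := by
  rw [circleAverage_cpot hμ hR, integral_sub (integrable_logMax hμ hR z)
    (integrable_log_norm_sub hμ z), cpot, integral_neg]
  ring

theorem circleIntegrable_of_continuous {f : ℂ → ℝ} (hf : Continuous f) (z : ℂ) (R : ℝ) :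
    CircleIntegrable f z R :=
  hf.continuousOn.circleIntegrable'

theorem circleAverage_potential_sub {μ ν : Measure ℝ} (hμ : μ ≤ sigma) (hν : ν ≤ sigma) (k : ℝ)
    (z : ℂ) (R : ℝ) :
    circleAverage (fun w => cpot μ w - cpot ν w + k) z R =
      circleAverage (cpot μ) z R - circleAverage (cpot ν) z R + k := by
  have h1 := circleIntegrable_of_continuous (continuous_cpot hμ) z R
  have h2 := circleIntegrable_of_continuous (continuous_cpot hν) z R
  rw [circleAverage_fun_add (f₁ := fun w => cpot μ w - cpot ν w) (h1.sub h2)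
    (circleIntegrable_const k z R), circleAverage_fun_sub h1 h2, circleAverage_const]

theorem isClosed_image_ofReal {S : Set ℝ} (hS : IsClosed S) :
    IsClosed ((fun x : ℝ => (x : ℂ)) '' S) :=
  Complex.isometry_ofReal.isClosedEmbedding.isClosedMap S hS

/-- The drop from centre value to circle average is the integral of a nonnegative kernel living on
the disc of radius `R`. In a disc missing the support of `sigma - μ` the drop for `μ` equals that
for `sigma`, which is at least that for `ν`. -/
theorem circleAverage_potential_sub_le {μ ν : Measure ℝ} (hμ : μ ≤ sigma) (hν : ν ≤ sigma) (k : ℝ)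
    {z : ℂ} (hz : z ∉ (fun x : ℝ => (x : ℂ)) '' (sigma - μ).support) :
    ∃ ε > 0, ∀ R ∈ Ioo 0 ε, circleAverage (fun w => cpot μ w - cpot ν w + k) z R ≤
      cpot μ z - cpot ν z + k := by
  have := isFiniteMeasure_of_le_sigma hμ
  have hcl := isClosed_image_ofReal (Measure.isClosed_support (μ := sigma - μ))
  obtain ⟨ε, hε, hb⟩ := Metric.isOpen_iff.1 hcl.isOpen_compl z hz
  refine ⟨ε, hε, fun R hR => ?_⟩
  rw [circleAverage_potential_sub hμ hν]
  have hsub : sigma - μ ≤ sigma := Measure.sub_le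
  have hint : ∀ {κ : Measure ℝ}, κ ≤ sigma →
      Integrable (fun y => logMax R z y - log ‖z - y‖) κ := fun hκ =>
    (integrable_logMax hκ hR.1 z).sub (integrable_log_norm_sub hκ z)
  have h1 := cpot_sub_circleAverage hμ hR.1 z
  have h2 := cpot_sub_circleAverage hν hR.1 z
  have h3 : ∫ y, (logMax R z y - log ‖z - y‖) ∂(sigma - μ) = 0 := by
    refine integral_eq_zero_of_ae ?_
    filter_upwards [Measure.support_mem_ae (μ := sigma - μ)] with y hy
    have : R ≤ ‖z - y‖ := by
      by_contra! hlt
      refine hb (a := (y : ℂ)) ?_ ⟨y, hy, rfl⟩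
      rw [Metric.mem_ball, dist_comm, dist_eq_norm]
      exact hlt.trans hR.2
    simp [logMax_of_ge hR.1 this]
  have h4 : ∫ y, (logMax R z y - log ‖z - y‖) ∂μ = ∫ y, (logMax R z y - log ‖z - y‖) ∂sigma := by
    conv_rhs => rw [← sigma_sub_add hμ, integral_add_measure (hint hsub) (hint hμ), h3, zero_add]
  have h5 : ∫ y, (logMax R z y - log ‖z - y‖) ∂ν ≤ ∫ y, (logMax R z y - log ‖z - y‖) ∂sigma := by
    refine integral_mono_measure hν ?_ (hint le_rfl)
    filter_upwards [ae_ne le_rfl z.re] with y hy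
    exact sub_nonneg.2 (log_le_logMax hR.1 (norm_sub_pos hy))
  linarith

theorem nonneg_of_nonneg_on_support {μ ν : Measure ℝ} (hμ : μ ≤ sigma) (hν : ν ≤ sigma)
    (hmass : μ univ = ν univ) (hne : (sigma - μ).support.Nonempty) {k : ℝ}
    (h : ∀ x ∈ (sigma - μ).support, 0 ≤ cpot μ x - cpot ν x + k) (z : ℂ) :
    0 ≤ cpot μ z - cpot ν z + k := by
  have hreal : μ.real univ = ν.real univ := by simp [Measure.real, hmass]
  have hD : Continuous fun w => cpot μ w - cpot ν w + k :=
    ((continuous_cpot hμ).sub (continuous_cpot hν)).add continuous_const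
  refine nonneg_of_superharmonic (D := fun w => cpot μ w - cpot ν w + k) hD
    (hne.image fun x : ℝ => (x : ℂ)) ?_
    (fun z hz => circleAverage_potential_sub_le hμ hν k hz) (c := k) ?_ (ρ := 2) ?_ z
  · rintro _ ⟨x, hx, rfl⟩
    exact h x hx
  · have := ((tendsto_cpot_add hμ).sub (tendsto_cpot_add hν)).add_const k
    simpa [hreal] using this
  · rw [circleAverage_potential_sub hμ hν, circleAverage_cpot_zero_two hμ,
      circleAverage_cpot_zero_two hν, hreal]
    ring

/-! ### Uniqueness -/

/-- Equal potentials up to a constant give equal integrals of `logMax R' - logMax R`. This function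
lies between `log R' - log R` times the indicators of the balls of radii `R` and `R'`; then `R'`
decreases to `R`. -/
theorem measure_closedBall_le {μ ν : Measure ℝ} (hμ : μ ≤ sigma) (hν : ν ≤ sigma) {k : ℝ}
    (h : ∀ z, cpot μ z - cpot ν z + k = 0) (x : ℝ) {R : ℝ} (hR : 0 < R) :
    μ (Metric.closedBall x R) ≤ ν (Metric.closedBall x R) := by
  have := isFiniteMeasure_of_le_sigma hμ
  have := isFiniteMeasure_of_le_sigma hν
  have hnorm : ∀ y : ℝ, ‖(x : ℂ) - y‖ = dist y x := fun y => by
    rw [← Complex.ofReal_sub, Complex.norm_real, dist_comm, dist_eq_norm]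
  have hF : ∀ r, 0 < r → ∫ y, logMax r x y ∂μ = ∫ y, logMax r x y ∂ν + k := fun r hr => by
    have h1 := circleAverage_potential_sub hμ hν k x r
    simp only [h, circleAverage_cpot hμ hr, circleAverage_cpot hν hr, circleAverage_const] at h1
    linarith
  have hle : ∀ R', R < R' → μ (Metric.closedBall x R) ≤ ν (Metric.closedBall x R') := by
    intro R' hR'
    have hR0 := hR.trans hR'
    have hL : 0 < log R' - log R := sub_pos.2 (log_lt_log hR hR')
    have hi : ∀ {κ : Measure ℝ}, κ ≤ sigma →
        Integrable (fun y => logMax R' x y - logMax R x y) κ := fun hκ =>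
      (integrable_logMax hκ hR0 x).sub (integrable_logMax hκ hR x)
    have heq : ∫ y, (logMax R' x y - logMax R x y) ∂μ =
        ∫ y, (logMax R' x y - logMax R x y) ∂ν := by
      rw [integral_sub (integrable_logMax hμ hR0 x) (integrable_logMax hμ hR x),
        integral_sub (integrable_logMax hν hR0 x) (integrable_logMax hν hR x), hF R hR, hF R' hR0]
      ring
    have hind : ∀ (κ : Measure ℝ) [IsFiniteMeasure κ] (r : ℝ),
        Integrable ((Metric.closedBall x r).indicator fun _ => log R' - log R) κ := fun κ _ r =>
      (integrable_const _).indicator Metric.isClosed_closedBall.measurableSet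
    have h1 : ∫ y, (Metric.closedBall x R).indicator (fun _ => log R' - log R) y ∂μ ≤
        ∫ y, (logMax R' x y - logMax R x y) ∂μ := by
      refine integral_mono (hind μ R) (hi hμ) fun y => ?_
      refine indicator_apply_le' (fun hy => ?_) fun hy => ?_
      · have hy' : ‖(x : ℂ) - y‖ ≤ R := (hnorm y).trans_le hy
        simp [logMax_of_le hR hy', logMax_of_le hR0 (hy'.trans hR'.le)]
      · have hy' : R ≤ ‖(x : ℂ) - y‖ := by
          rw [hnorm]
          exact (not_le.1 hy).le
        simp only [logMax_of_ge hR hy']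
        exact sub_nonneg.2 (log_le_logMax hR0 (hR.trans_le hy'))
    have h2 : ∫ y, (logMax R' x y - logMax R x y) ∂ν ≤
        ∫ y, (Metric.closedBall x R').indicator (fun _ => log R' - log R) y ∂ν := by
      refine integral_mono (hi hν) (hind ν R') fun y => ?_
      refine le_indicator_apply (fun hy => ?_) fun hy => ?_
      · have hy' : ‖(x : ℂ) - y‖ ≤ R' := (hnorm y).trans_le hy
        simp only [logMax_of_le hR0 hy']
        have : log R ≤ logMax R x y := le_add_of_nonneg_right posLog_nonneg
        linarith
      · have hy' : R' ≤ ‖(x : ℂ) - y‖ := by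
          rw [hnorm]
          exact (not_le.1 hy).le
        simp [logMax_of_ge hR0 hy', logMax_of_ge hR (hR'.le.trans hy')]
    rw [integral_indicator_const _ Metric.isClosed_closedBall.measurableSet, smul_eq_mul] at h1 h2
    have h3 := le_of_mul_le_mul_right (h1.trans (heq.trans_le h2)) hL
    exact (ENNReal.toReal_le_toReal (measure_ne_top _ _) (measure_ne_top _ _)).1 h3
  have hlim := tendsto_measure_biInter_gt (μ := ν) (s := fun r => Metric.closedBall x r) (a := R)
    (fun r _ => Metric.isClosed_closedBall.measurableSet.nullMeasurableSet)
    (fun i j _ hij => Metric.closedBall_subset_closedBall hij)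
    ⟨R + 1, by simp, measure_ne_top _ _⟩
  have hInter : ⋂ r, ⋂ (_ : r > R), Metric.closedBall x r = Metric.closedBall x R := by
    ext y
    simp only [mem_iInter, Metric.mem_closedBall]
    exact ⟨fun h => le_of_forall_gt_imp_ge_of_dense h, fun h r hr => h.trans (le_of_lt hr)⟩
  rw [hInter] at hlim
  exact ge_of_tendsto hlim (eventually_mem_nhdsWithin.mono fun r hr => hle r hr)

theorem eq_of_cpot_sub_eq {μ ν : Measure ℝ} (hμ : μ ≤ sigma) (hν : ν ≤ sigma) {k : ℝ}
    (h : ∀ z, cpot μ z - cpot ν z + k = 0) : μ = ν := by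
  have := isFiniteMeasure_of_le_sigma hμ
  refine Measure.ext_of_Icc μ ν fun a b hab => ?_
  rcases hab.eq_or_lt with rfl | hab
  · have h0 : ∀ {κ : Measure ℝ}, κ ≤ sigma → κ {a} = 0 := fun hκ =>
      le_antisymm ((hκ _).trans (measure_singleton a).le) bot_le
    simp [h0 hμ, h0 hν]
  · rw [Real.Icc_eq_closedBall]
    have hR : 0 < (b - a) / 2 := by linarith
    exact le_antisymm (measure_closedBall_le hμ hν h _ hR)
      (measure_closedBall_le hν hμ (k := -k) (fun z => by linarith [h z]) _ hR)

theorem eq_of_zero_off_support {μ ν : Measure ℝ} (hμ : μ ≤ sigma) (hν : ν ≤ sigma) {k : ℝ}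
    (h : ∀ z, 0 ≤ cpot μ z - cpot ν z + k) {x : ℝ} (hx : x ∉ (sigma - μ).support)
    (hx0 : cpot μ x - cpot ν x + k = 0) : μ = ν := by
  have hD : Continuous fun w => cpot μ w - cpot ν w + k :=
    ((continuous_cpot hμ).sub (continuous_cpot hν)).add continuous_const
  have hup : ∀ z : ℂ, 0 ≤ z.im → cpot μ z - cpot ν z + k = 0 := fun z hz =>
    eq_zero_of_superharmonic (D := fun w => cpot μ w - cpot ν w + k) hD
      (S := (fun x : ℝ => (x : ℂ)) '' (sigma - μ).support)
      (by rintro _ ⟨y, _, rfl⟩; exact Complex.ofReal_im y) h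
      (fun z hz => circleAverage_potential_sub_le hμ hν k hz) (x := x)
      (by rintro ⟨y, hy, hyx⟩; exact hx (Complex.ofReal_inj.1 hyx ▸ hy)) hx0 hz
  refine eq_of_cpot_sub_eq hμ hν (k := k) fun z => ?_
  rcases le_total 0 z.im with hz | hz
  · exact hup z hz
  · have := hup (starRingEnd ℂ z) (by simpa using hz)
    rwa [cpot_conj, cpot_conj] at this

/-! ### The logarithmic potential of the arcsine distribution -/

/-- The logarithmic potential at `x` of the arcsine distribution on `[-s, s]`. -/
def arcsinePotential (s x : ℝ) : ℝ := π⁻¹ * ∫ θ in Ioo 0 π, -log (x - s * cos θ)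

/-- With `w = exp (iθ)` and `x = (s/2)(p + 1/p)`, the quantity `x - s cos θ` factors as `-(s/2)(w -
p)(w - 1/p)/w`, and `|w| = 1`. -/
theorem circleMap_joukowski (s x θ : ℝ) {p : ℂ} (hp : p ≠ 0)
    (hx : ((s / 2 : ℝ) : ℂ) * (p + p⁻¹) = x) :
    |x - s * cos θ| = |s / 2| * (‖circleMap 0 1 θ - p‖ * ‖circleMap 0 1 θ - p⁻¹‖) := by
  have hw : ‖circleMap 0 1 θ‖ = 1 := by simp
  have hw0 : circleMap 0 1 θ ≠ 0 := norm_ne_zero_iff.1 (by rw [hw]; exact one_ne_zero)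
  have hinv : (circleMap 0 1 θ)⁻¹ = circleMap 0 1 (-θ) := by
    simp [circleMap, ← Complex.exp_neg]
  have hcos : (2 * cos θ : ℂ) = circleMap 0 1 θ + (circleMap 0 1 θ)⁻¹ := by
    rw [hinv]
    simp [circleMap, Complex.two_cos]
  have key : ((x - s * cos θ : ℝ) : ℂ) * circleMap 0 1 θ =
      -(((s / 2 : ℝ) : ℂ) * ((circleMap 0 1 θ - p) * (circleMap 0 1 θ - p⁻¹))) := by
    have h1 : ((x - s * cos θ : ℝ) : ℂ) =
        ((s / 2 : ℝ) : ℂ) * (p + p⁻¹ - (circleMap 0 1 θ + (circleMap 0 1 θ)⁻¹)) := by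
      rw [mul_sub, hx, ← hcos]
      push_cast
      ring
    rw [h1]
    field_simp
    ring
  have := congrArg norm key
  rwa [norm_mul, hw, mul_one, norm_neg, norm_mul, norm_mul, Complex.norm_real, Complex.norm_real]
    at this

/-- After the Joukowski factorization two circle averages remain: the root `p` contributes `log
‖p‖`, and `p⁻¹`, in the closed unit disc, contributes `0`. The symmetry `θ ↦ 2π - θ` reduces the
full circle to `(0, π)`. -/
theorem arcsinePotential_eq {s x : ℝ} (hs : 0 < s) {p : ℂ} (hp : 1 ≤ ‖p‖)
    (hx : ((s / 2 : ℝ) : ℂ) * (p + p⁻¹) = x) : arcsinePotential s x = log (2 / (s * ‖p‖)) := by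
  have hp0 : p ≠ 0 := norm_pos_iff.1 (by linarith)
  have hc : ∀ q : ℂ, CircleIntegrable (fun w => log ‖w - q‖) 0 1 := fun q =>
    circleIntegrable_log_norm_sub_const 1
  have hsum : CircleIntegrable (fun w => log (s / 2) + (log ‖w - p‖ + log ‖w - p⁻¹‖)) 0 1 :=
    (circleIntegrable_const _ _ _).add ((hc p).add (hc p⁻¹))
  -- When `‖p‖ = 1` the roots lie on the circle, where the logarithm of the product does not split;
  -- they are avoided almost everywhere.
  have hae : ∀ q : ℂ, ∀ᵐ θ : ℝ, circleMap 0 1 θ ≠ q := fun q =>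
    ((countable_singleton q).preimage_circleMap 0 one_ne_zero).ae_notMem volume
  have heq : ∀ᵐ θ : ℝ, log (s / 2) + (log ‖circleMap 0 1 θ - p‖ + log ‖circleMap 0 1 θ - p⁻¹‖) =
      log (x - s * cos θ) := by
    filter_upwards [hae p, hae p⁻¹] with θ h1 h2
    have h1' := norm_ne_zero_iff.2 (sub_ne_zero.2 h1)
    have h2' := norm_ne_zero_iff.2 (sub_ne_zero.2 h2)
    rw [← log_abs (x - _), circleMap_joukowski s x θ hp0 hx, abs_of_pos (half_pos hs),
      log_mul (half_pos hs).ne' (mul_ne_zero h1' h2'), log_mul h1' h2']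
  have hint : IntervalIntegrable (fun θ => log (x - s * cos θ)) volume 0 (2 * π) :=
    IntervalIntegrable.congr_ae hsum (ae_restrict_of_ae heq)
  have hfull : ∫ θ in (0 : ℝ)..2 * π, log (x - s * cos θ) = 2 * π * (log (s / 2) + log ‖p‖) := by
    have h1 := circleAverage_fun_add (f₁ := fun _ => log (s / 2))
      (f₂ := fun w => log ‖w - p‖ + log ‖w - p⁻¹‖) (circleIntegrable_const _ (0 : ℂ) 1)
      ((hc p).add (hc p⁻¹))
    rw [circleAverage_fun_add (hc p) (hc p⁻¹), circleAverage_const,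
      circleAverage_log_norm_sub_const_eq_posLog, circleAverage_log_norm_sub_const_eq_posLog,
      circleAverage_def, smul_eq_mul, inv_mul_eq_iff_eq_mul₀ two_pi_pos.ne',
      posLog_eq_log (by simpa using hp), posLog_eq_zero_iff _ |>.2 (by
        rw [norm_inv, abs_of_nonneg (by positivity)]; exact inv_le_one_of_one_le₀ hp),
      add_zero] at h1
    rw [← h1]
    exact (intervalIntegral.integral_congr_ae (heq.mono fun θ h _ => h)).symm
  have hpi : 0 ≤ π := pi_pos.le
  have hsplit : ∫ θ in (0 : ℝ)..2 * π, log (x - s * cos θ) =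
      2 * ∫ θ in (0 : ℝ)..π, log (x - s * cos θ) := by
    have hsub : ∫ θ in π..2 * π, log (x - s * cos θ) = ∫ θ in (0 : ℝ)..π, log (x - s * cos θ) := by
      have := intervalIntegral.integral_comp_sub_left (a := 0) (b := π)
        (fun θ => log (x - s * cos θ)) (2 * π)
      simp only [cos_two_pi_sub, sub_zero] at this
      rw [this]
      congr 1
      ring
    rw [← intervalIntegral.integral_add_adjacent_intervals (b := π), hsub, two_mul]
    · refine hint.mono_set ?_
      rw [uIcc_of_le hpi, uIcc_of_le two_pi_pos.le]
      exact Icc_subset_Icc_right (by linarith)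
    · refine hint.mono_set ?_
      rw [uIcc_of_le (by linarith), uIcc_of_le two_pi_pos.le]
      exact Icc_subset_Icc_left hpi
  rw [arcsinePotential, integral_neg, ← integral_Ioc_eq_integral_Ioo,
    ← intervalIntegral.integral_of_le hpi]
  have h2 : ∫ θ in (0 : ℝ)..π, log (x - s * cos θ) = π * (log (s / 2) + log ‖p‖) := by
    linarith
  rw [h2, log_div two_ne_zero (by positivity), log_mul hs.ne' (by positivity),
    log_div hs.ne' two_ne_zero]
  field_simp
  ring

theorem arcsinePotential_of_abs_le {s x : ℝ} (hs : 0 < s) (hx : |x| ≤ s) :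
    arcsinePotential s x = log (2 / s) := by
  have hp : ‖Complex.exp (arccos (x / s) * Complex.I)‖ = 1 := Complex.norm_exp_ofReal_mul_I _
  rw [arcsinePotential_eq hs hp.ge, hp, mul_one]
  have hxs := abs_le.1 hx
  rw [← Complex.exp_neg, ← neg_mul, ← Complex.two_cos, ← Complex.ofReal_cos,
    cos_arccos (by rw [le_div_iff₀ hs]; linarith) (by rw [div_le_iff₀ hs]; linarith)]
  push_cast
  have := Complex.ofReal_ne_zero.2 hs.ne'
  field_simp

theorem arcsinePotential_of_le_abs {s x : ℝ} (hs : 0 < s) (hx : s ≤ |x|) :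
    arcsinePotential s x = log (2 / (|x| + √(x ^ 2 - s ^ 2))) := by
  have hx0 : 0 < |x| := hs.trans_le hx
  have hxne : x ≠ 0 := abs_pos.1 hx0
  have hsq : s ^ 2 ≤ x ^ 2 := by rw [← sq_abs x]; gcongr
  set q := √(x ^ 2 - s ^ 2) with hq
  have hq0 : 0 ≤ q := sqrt_nonneg _
  have hq2 : q ^ 2 = x ^ 2 - s ^ 2 := sq_sqrt (by linarith)
  have hpos : 0 < |x| + q := by positivity
  -- The sign `e` of `x` selects the real Joukowski root `p = e (|x| + q) / s` with `‖p‖ ≥ 1`.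
  obtain ⟨e, he, hxe⟩ : ∃ e : ℝ, |e| = 1 ∧ e * |x| = x := by
    rcases abs_cases x with h | h
    · exact ⟨1, by simp, by simp [h.1]⟩
    · exact ⟨-1, by simp, by simp [h.1]⟩
  have he2 : e⁻¹ = e := by
    rcases eq_or_eq_neg_of_abs_eq he with rfl | rfl <;> norm_num
  have hp : ‖((e * ((|x| + q) / s) : ℝ) : ℂ)‖ = (|x| + q) / s := by
    rw [Complex.norm_real, norm_mul, norm_eq_abs, he, one_mul, norm_of_nonneg (by positivity)]
  rw [arcsinePotential_eq hs (p := ((e * ((|x| + q) / s) : ℝ) : ℂ)), hp,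
    mul_div_cancel₀ _ hs.ne']
  · rw [hp, one_le_div hs]
    linarith
  · have hinv : ((|x| + q) / s)⁻¹ = (|x| - q) / s := by
      rw [inv_div, div_eq_div_iff hpos.ne' hs.ne']
      linear_combination hq2 - sq_abs x
    rw [← Complex.ofReal_inv, ← Complex.ofReal_add, ← Complex.ofReal_mul, Complex.ofReal_inj,
      mul_inv, he2, hinv]
    field_simp
    linear_combination hxe * 2

theorem arcsinePotential_le {s : ℝ} (hs : 0 < s) (x : ℝ) :
    arcsinePotential s x ≤ log (2 / s) := by
  rcases le_total |x| s with h | h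
  · exact (arcsinePotential_of_abs_le hs h).le
  · rw [arcsinePotential_of_le_abs hs h]
    have := sqrt_nonneg (x ^ 2 - s ^ 2)
    exact log_le_log (div_pos two_pos (by linarith)) (by gcongr; linarith)

theorem arcsinePotential_one {s : ℝ} (hs : 0 < s) (hs1 : s ≤ 1) :
    arcsinePotential s 1 = log (2 / (1 + √(1 - s ^ 2))) := by
  simpa using arcsinePotential_of_le_abs hs (x := 1) (by simpa using hs1)

theorem arcsinePotential_one_le {s x : ℝ} (hs : 0 < s) (hs1 : s ≤ 1) (hx : |x| ≤ 1) :
    arcsinePotential s 1 ≤ arcsinePotential s x := by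
  rw [arcsinePotential_one hs hs1]
  rcases le_total |x| s with h | h
  · rw [arcsinePotential_of_abs_le hs h]
    have := sqrt_nonneg (1 - s ^ 2)
    exact log_le_log (by positivity) (by gcongr; linarith)
  · rw [arcsinePotential_of_le_abs hs h]
    have := sqrt_nonneg (x ^ 2 - s ^ 2)
    have hx2 : x ^ 2 ≤ 1 := by rw [← sq_abs]; exact pow_le_one₀ (abs_nonneg _) hx
    have hx0 : 0 < |x| := hs.trans_le h
    exact log_le_log (div_pos two_pos (by linarith [sqrt_nonneg (1 - s ^ 2)])) (by gcongr)

/-! ### `muAlpha` as a mixture of arcsine distributions -/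

theorem lintegral_comp_mul_cos {s : ℝ} (hs : 0 < s) (f : ℝ → ENNReal) :
    ∫⁻ θ in Ioo 0 π, f (s * cos θ) = ∫⁻ y, f y * ENNReal.ofReal (√(s ^ 2 - y ^ 2))⁻¹ := by
  have himage : (fun θ => s * cos θ) '' Ioo 0 π = Ioo (-s) s := by
    ext y
    constructor
    · rintro ⟨θ, hθ, rfl⟩
      have := mapsTo_cos_Ioo hθ
      exact ⟨by nlinarith [this.1], by nlinarith [this.2]⟩
    · rintro ⟨h1, h2⟩
      refine ⟨arccos (y / s), ⟨arccos_pos.2 ?_, arccos_lt_pi.2 ?_⟩, ?_⟩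
      · rwa [div_lt_one hs]
      · rw [lt_div_iff₀ hs]; linarith
      · change s * cos (arccos (y / s)) = y
        rw [cos_arccos (by rw [le_div_iff₀ hs]; linarith) (by rw [div_le_iff₀ hs]; linarith)]
        field_simp
  have hinj : InjOn (fun θ => s * cos θ) (Ioo 0 π) := fun a ha b hb hab =>
    injOn_cos (Ioo_subset_Icc_self ha) (Ioo_subset_Icc_self hb) (mul_left_cancel₀ hs.ne' hab)
  have hderiv : ∀ θ ∈ Ioo 0 π, HasDerivWithinAt (fun θ => s * cos θ) (s * -sin θ) (Ioo 0 π) θ :=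
    fun θ _ => ((hasDerivAt_cos θ).const_mul s).hasDerivWithinAt
  have h1 := lintegral_image_eq_lintegral_abs_deriv_mul measurableSet_Ioo hderiv hinj
    fun y => f y * ENNReal.ofReal (√(s ^ 2 - y ^ 2))⁻¹
  rw [himage] at h1
  -- Outside `(-s, s)` the square root of a nonpositive number is `0`, and so is its inverse; no
  -- indicator is needed.
  have h2 : ∫⁻ y in Ioo (-s) s, f y * ENNReal.ofReal (√(s ^ 2 - y ^ 2))⁻¹ =
      ∫⁻ y, f y * ENNReal.ofReal (√(s ^ 2 - y ^ 2))⁻¹ := by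
    refine setLIntegral_eq_of_support_subset fun y hy => ?_
    by_contra hy'
    refine hy ?_
    have : s ^ 2 - y ^ 2 ≤ 0 := by
      have := fun h => hy' (abs_lt.1 (abs_lt_of_sq_lt_sq h hs.le))
      exact sub_nonpos.2 (not_lt.1 this)
    simp [sqrt_eq_zero_of_nonpos this]
  rw [← h2, h1]
  refine setLIntegral_congr_fun measurableSet_Ioo fun θ hθ => ?_
  have hsin : 0 < sin θ := sin_pos_of_mem_Ioo hθ
  have h3 : √(s ^ 2 - (s * cos θ) ^ 2) = s * sin θ := by
    rw [show s ^ 2 - (s * cos θ) ^ 2 = (s * sin θ) ^ 2 by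
      have := sin_sq_add_cos_sq θ
      linear_combination (-s ^ 2) * this]
    exact sqrt_sq (by positivity)
  have h4 : |s * -sin θ| = s * sin θ := by rw [mul_neg, abs_neg, abs_of_pos (by positivity)]
  simp only [h3, h4]
  rw [mul_comm (f _), ← mul_assoc, ← ENNReal.ofReal_mul (by positivity),
    mul_inv_cancel₀ (by positivity), ENNReal.ofReal_one, one_mul]

/-- The primitive `arcsin (t / b)` is continuous up to `t = b`, so the singular endpoint `c = b` is
allowed; integrability comes from the sign of the derivative. -/
theorem lintegral_inv_sqrt {b c : ℝ} (hc : 0 < c) (hcb : c ≤ b) :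
    ∫⁻ t in Ioo 0 c, ENNReal.ofReal (√(b ^ 2 - t ^ 2))⁻¹ = ENNReal.ofReal (arcsin (c / b)) := by
  have hb : 0 < b := hc.trans_le hcb
  have hcont : ContinuousOn (fun t => arcsin (t / b)) (Icc 0 c) := by fun_prop
  have hderiv : ∀ t ∈ Ioo 0 c, HasDerivAt (fun t => arcsin (t / b)) (√(b ^ 2 - t ^ 2))⁻¹ t := by
    intro t ht
    have htb : t / b < 1 := by rw [div_lt_one hb]; exact ht.2.trans_le hcb
    have ht0 : 0 < t / b := div_pos ht.1 hb
    have h := (hasDerivAt_arcsin (x := t / b) (by linarith) htb.ne).comp t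
      ((hasDerivAt_id t).div_const b)
    refine h.congr_deriv ?_
    rw [show b ^ 2 - t ^ 2 = b ^ 2 * (1 - (t / b) ^ 2) by field_simp, sqrt_mul (sq_nonneg b),
      sqrt_sq hb.le]
    field_simp
  have hnn : ∀ t ∈ Ioo 0 c, 0 ≤ (√(b ^ 2 - t ^ 2))⁻¹ := fun t _ => by positivity
  have hint := intervalIntegral.integrableOn_deriv_of_nonneg hcont hderiv hnn
  have hftc := intervalIntegral.integral_eq_sub_of_hasDerivAt_of_le hc.le hcont hderiv
    ((intervalIntegrable_iff_integrableOn_Ioc_of_le hc.le).2 hint)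
  rw [intervalIntegral.integral_of_le hc.le, integral_Ioc_eq_integral_Ioo] at hftc
  rw [← ofReal_integral_eq_lintegral_ofReal (hint.mono_set Ioo_subset_Ioc_self)
    (Eventually.of_forall fun t => by positivity), hftc]
  simp

theorem sq_radius {α : ℝ} (hα₀ : 0 < α) (hα₁ : α < 1) : radius α ^ 2 = 1 - α ^ 2 :=
  sq_sqrt (by nlinarith)

theorem radius_nonneg (α : ℝ) : 0 ≤ radius α := sqrt_nonneg _

theorem radius_lt_one {α : ℝ} (hα₀ : 0 < α) (hα₁ : α < 1) : radius α < 1 := by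
  nlinarith [sq_radius hα₀ hα₁, radius_nonneg α]

/-- With `b = √(1 - y²)`, only `t < b` contributes. For `|y| < r` one has `α < b` and gets `arcsin
(α / b)`; for `r ≤ |y| < 1` the integral saturates at `arcsin 1 = π / 2`. At `|y| = 1` the integral
is `0` but the density is `1/2`, hence the exclusion. -/
theorem lintegral_inv_sqrt_eq_density {α : ℝ} (hα₀ : 0 < α) (hα₁ : α < 1) {y : ℝ} (hy : |y| ≠ 1) :
    ∫⁻ t in Ioo 0 α, ENNReal.ofReal (√(1 - y ^ 2 - t ^ 2))⁻¹ =
      ENNReal.ofReal (π * muAlphaDensity α y) := by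
  have hr := sq_radius hα₀ hα₁
  have hr0 := radius_nonneg α
  have hr1 := radius_lt_one hα₀ hα₁
  have hy0 := abs_nonneg y
  have hy2 : |y| ^ 2 = y ^ 2 := sq_abs y
  rcases lt_or_gt_of_ne hy with hy1 | hy1
  · set b := √(1 - y ^ 2) with hb
    have hb2 : b ^ 2 = 1 - y ^ 2 := sq_sqrt (by nlinarith)
    have hb0 : 0 < b := sqrt_pos.2 (by nlinarith)
    rw [← hb2]
    by_cases hyr : |y| < radius α
    · have hαb : α < b := by
        refine lt_of_pow_lt_pow_left₀ 2 hb0.le ?_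
        nlinarith
      rw [lintegral_inv_sqrt hα₀ hαb.le, arcsin_eq_arctan ⟨by linarith [div_pos hα₀ hb0],
        (div_lt_one hb0).2 hαb⟩, muAlphaDensity, if_pos hyr]
      have h1 : α / b / √(1 - (α / b) ^ 2) = α / √(radius α ^ 2 - y ^ 2) := by
        rw [show radius α ^ 2 - y ^ 2 = b ^ 2 * (1 - (α / b) ^ 2) by
          field_simp; rw [hb2, hr]; ring, sqrt_mul (sq_nonneg b), sqrt_sq hb0.le, div_div]
      rw [h1]
      congr 1
      field_simp
    · have hbα : b ≤ α := by
        refine le_of_sq_le_sq ?_ hα₀.le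
        nlinarith
      have h1 : ∫⁻ t in Ioo 0 α, ENNReal.ofReal (√(b ^ 2 - t ^ 2))⁻¹ =
          ∫⁻ t in Ioo 0 b, ENNReal.ofReal (√(b ^ 2 - t ^ 2))⁻¹ := by
        rw [← lintegral_indicator measurableSet_Ioo, ← lintegral_indicator measurableSet_Ioo]
        congr with t
        by_cases htb : t < b
        · simp [indicator_apply, htb, htb.trans_le hbα]
        · have hz : t ∈ Ioo 0 α → b ^ 2 - t ^ 2 ≤ 0 := fun ht => by nlinarith
          by_cases ht : t ∈ Ioo 0 α
          · simp [indicator_apply, htb, sqrt_eq_zero_of_nonpos (hz ht)]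
          · simp [htb, ht]
      rw [h1, lintegral_inv_sqrt hb0 le_rfl, div_self hb0.ne', arcsin_one, muAlphaDensity,
        if_neg hyr, if_pos hy1.le]
      congr 1
      ring
  · have hyr : ¬ |y| < radius α := by linarith
    have h0 : ∀ t : ℝ, 1 - y ^ 2 - t ^ 2 ≤ 0 := fun t => by nlinarith [sq_nonneg t]
    simp [muAlphaDensity, hyr, not_le.2 hy1, sqrt_eq_zero_of_nonpos (h0 _)]

theorem measurable_muAlphaDensity (α : ℝ) : Measurable (muAlphaDensity α) := by
  unfold muAlphaDensity
  refine Measurable.ite (measurableSet_lt (by fun_prop) (by fun_prop)) ?_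
    (Measurable.ite (measurableSet_le (by fun_prop) (by fun_prop)) measurable_const
      measurable_const)
  exact measurable_const.mul (measurable_arctan.comp (by fun_prop))

/-- Lebesgue measure on the rectangle of parameters `(t, θ) ∈ (0, α) × (0, π)`. -/
def paramMeasure (α : ℝ) : Measure (ℝ × ℝ) :=
  (volume.restrict (Ioo 0 α)).prod (volume.restrict (Ioo 0 π))

/-- The parametrization `(t, θ) ↦ √(1 - t²) cos θ`. -/
def paramMap (p : ℝ × ℝ) : ℝ := √(1 - p.1 ^ 2) * cos p.2

theorem measurable_paramMap : Measurable paramMap := by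
  unfold paramMap
  fun_prop

instance (α : ℝ) : IsFiniteMeasure (paramMeasure α) := by
  unfold paramMeasure
  infer_instance

/-- Tonelli: for fixed `t` the substitution `y = √(1 - t²) cos θ` produces an arcsine density, and
integrating it over `t` first gives `π` times the density of `muAlpha α`. -/
theorem muAlpha_eq_map {α : ℝ} (hα₀ : 0 < α) (hα₁ : α < 1) :
    muAlpha α = ENNReal.ofReal π⁻¹ • (paramMeasure α).map paramMap := by
  refine Measure.ext_of_lintegral _ fun f hf => ?_
  rw [lintegral_smul_measure, lintegral_map hf measurable_paramMap, paramMeasure,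
    lintegral_prod (fun p => f (paramMap p)) (hf.comp measurable_paramMap).aemeasurable, muAlpha,
    lintegral_withDensity_eq_lintegral_mul _ (measurable_muAlphaDensity α).ennreal_ofReal hf]
  have h1 : ∀ t ∈ Ioo 0 α, ∫⁻ θ in Ioo 0 π, f (paramMap (t, θ)) =
      ∫⁻ y, f y * ENNReal.ofReal (√(1 - y ^ 2 - t ^ 2))⁻¹ := by
    intro t ht
    have ht1 : 0 < 1 - t ^ 2 := by nlinarith [ht.1, ht.2]
    simp only [paramMap]
    rw [lintegral_comp_mul_cos (sqrt_pos.2 ht1), sq_sqrt ht1.le]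
    congr with y
    ring_nf
  rw [setLIntegral_congr_fun measurableSet_Ioo h1, lintegral_lintegral_swap (by fun_prop),
    smul_eq_mul, ← lintegral_const_mul _ (by fun_prop)]
  refine lintegral_congr_ae ?_
  filter_upwards [Measure.ae_ne volume (1 : ℝ), Measure.ae_ne volume (-1 : ℝ)] with y hy hy'
  have hy1 : |y| ≠ 1 := fun h => by
    rcases eq_or_eq_neg_of_abs_eq h with h | h
    exacts [hy h, hy' h]
  rw [lintegral_const_mul _ (by fun_prop), lintegral_inv_sqrt_eq_density hα₀ hα₁ hy1,
    ENNReal.ofReal_mul pi_pos.le, Pi.mul_apply, mul_left_comm, ← mul_assoc (ENNReal.ofReal π⁻¹),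
    ← ENNReal.ofReal_mul (by positivity), inv_mul_cancel₀ pi_pos.ne', ENNReal.ofReal_one, one_mul,
    mul_comm]

/-! ### `muAlpha` belongs to the constrained class -/

theorem muAlpha_univ {α : ℝ} (hα₀ : 0 < α) (hα₁ : α < 1) : muAlpha α univ = ENNReal.ofReal α := by
  rw [muAlpha_eq_map hα₀ hα₁, Measure.smul_apply, Measure.map_apply measurable_paramMap
    MeasurableSet.univ, preimage_univ, paramMeasure, ← univ_prod_univ, Measure.prod_prod,
    Measure.restrict_apply_univ, Measure.restrict_apply_univ, Real.volume_Ioo, Real.volume_Ioo,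
    smul_eq_mul, sub_zero, sub_zero, ← ENNReal.ofReal_mul hα₀.le,
    ← ENNReal.ofReal_mul (by positivity)]
  congr 1
  field_simp

theorem sigma_apply_eq_lintegral {A : Set ℝ} (hA : MeasurableSet A) :
    sigma A = ∫⁻ x in A, (Icc (-1) 1).indicator (fun _ => ENNReal.ofReal (1 / 2)) x := by
  rw [lintegral_indicator_const measurableSet_Icc, sigma, Measure.smul_apply, smul_eq_mul,
    Measure.restrict_apply hA, Measure.restrict_apply measurableSet_Icc, inter_comm, one_div,
    ENNReal.ofReal_inv_of_pos two_pos, ENNReal.ofReal_ofNat]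

theorem muAlphaDensity_le {α : ℝ} (hα₀ : 0 < α) (hα₁ : α < 1) (x : ℝ) :
    ENNReal.ofReal (muAlphaDensity α x) ≤
      (Icc (-1) 1).indicator (fun _ => ENNReal.ofReal (1 / 2)) x := by
  have hr := radius_lt_one hα₀ hα₁
  unfold muAlphaDensity
  split_ifs with h1 h2
  · rw [indicator_of_mem (show x ∈ Icc (-1) 1 from abs_le.1 (h1.trans hr).le)]
    refine ENNReal.ofReal_le_ofReal ?_
    rw [one_div_mul_eq_div, div_le_iff₀ pi_pos]
    linarith [arctan_lt_pi_div_two (α / √(radius α ^ 2 - x ^ 2))]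
  · rw [indicator_of_mem (show x ∈ Icc (-1) 1 from abs_le.1 h2)]
  · simp

theorem muAlpha_le_sigma {α : ℝ} (hα₀ : 0 < α) (hα₁ : α < 1) : muAlpha α ≤ sigma := by
  refine Measure.le_iff.2 fun A hA => ?_
  rw [muAlpha, withDensity_apply _ hA, sigma_apply_eq_lintegral hA]
  exact lintegral_mono fun x => muAlphaDensity_le hα₀ hα₁ x

theorem muAlpha_mem {α : ℝ} (hα₀ : 0 < α) (hα₁ : α < 1) : muAlpha α ∈ constrainedMeasures α :=
  ⟨muAlpha_univ hα₀ hα₁, muAlpha_le_sigma hα₀ hα₁⟩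

theorem support_sigma_sub_nonempty {α : ℝ} (hα₁ : α < 1) {μ : Measure ℝ}
    (hμ : μ ∈ constrainedMeasures α) : (sigma - μ).support.Nonempty := by
  refine Measure.nonempty_support fun h => ?_
  have h1 := congrArg (· univ) (sigma_sub_add hμ.2)
  simp only [h, zero_add, sigma_univ, hμ.1] at h1
  exact (ENNReal.ofReal_lt_one.2 hα₁).ne h1

theorem support_sigma_sub_subset (μ : Measure ℝ) : (sigma - μ).support ⊆ Icc (-1) 1 := by
  refine Measure.support_subset_of_isClosed isClosed_Icc ?_
  exact (Measure.absolutelyContinuous_of_le Measure.sub_le).ae_le ae_sigma_mem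

theorem support_sigma_sub_muAlpha_subset {α : ℝ} (hα₀ : 0 < α) (hα₁ : α < 1) :
    (sigma - muAlpha α).support ⊆ {x | |x| ≤ radius α} := by
  have := isFiniteMeasure_of_le_sigma (muAlpha_le_sigma hα₀ hα₁)
  have hcl : IsClosed {x : ℝ | |x| ≤ radius α} := isClosed_le continuous_abs continuous_const
  refine Measure.support_subset_of_isClosed hcl ?_
  have hA := hcl.measurableSet.compl
  rw [mem_ae_iff, Measure.sub_apply hA (muAlpha_le_sigma hα₀ hα₁), tsub_eq_zero_iff_le, muAlpha,
    withDensity_apply _ hA, sigma_apply_eq_lintegral hA]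
  refine setLIntegral_mono' hA fun x hx => ?_
  have hx' : ¬ |x| < radius α := fun h => hx h.le
  rw [muAlphaDensity, if_neg hx']
  by_cases h : x ∈ Icc (-1) 1
  · rw [indicator_of_mem h, if_pos (abs_le.2 h)]
  · rw [indicator_of_notMem h]
    exact zero_le

/-! ### The potential of `muAlpha` -/

theorem integrable_paramMeasure {α : ℝ} (hα₀ : 0 < α) (hα₁ : α < 1) (x : ℝ) :
    Integrable (fun p => -log (x - paramMap p)) (paramMeasure α) := by
  have h := (integrable_log_sub (muAlpha_le_sigma hα₀ hα₁) x).neg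
  rw [muAlpha_eq_map hα₀ hα₁, integrable_smul_measure
    (ENNReal.ofReal_pos.2 (inv_pos.2 pi_pos)).ne' ENNReal.ofReal_ne_top] at h
  exact h.comp_measurable measurable_paramMap

theorem logPotential_muAlpha {α : ℝ} (hα₀ : 0 < α) (hα₁ : α < 1) (x : ℝ) :
    IntegrableOn (fun t => arcsinePotential (√(1 - t ^ 2)) x) (Ioo 0 α) ∧
      logPotential (muAlpha α) x = ∫ t in Ioo 0 α, arcsinePotential (√(1 - t ^ 2)) x := by
  have hint := integrable_paramMeasure hα₀ hα₁ x
  constructor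
  · exact (Integrable.integral_prod_left hint).const_mul _
  · have hk : logKernel x = fun y => -log (x - y) := by
      ext y; simp [logKernel]
    rw [logPotential, hk, muAlpha_eq_map hα₀ hα₁, integral_smul_measure,
      integral_map measurable_paramMap.aemeasurable
        (by fun_prop : Measurable fun y => -log (x - y)).aestronglyMeasurable,
      ENNReal.toReal_ofReal (by positivity), smul_eq_mul, paramMeasure, integral_prod _ hint,
      ← integral_const_mul]
    rfl

theorem sqrt_one_sub_sq_bounds {α t : ℝ} (hα₁ : α < 1) (ht : t ∈ Ioo 0 α) :
    0 < √(1 - t ^ 2) ∧ √(1 - t ^ 2) ≤ 1 ∧ radius α ≤ √(1 - t ^ 2) ∧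
      √(1 - √(1 - t ^ 2) ^ 2) = t := by
  have h1 : 0 < 1 - t ^ 2 := by nlinarith [ht.1, ht.2]
  refine ⟨sqrt_pos.2 h1, sqrt_le_one.2 (by nlinarith), sqrt_le_sqrt ?_, ?_⟩
  · nlinarith [ht.1, ht.2]
  · rw [sq_sqrt h1.le, sub_sub_cancel, sqrt_sq ht.1.le]

theorem logPotential_muAlpha_of_abs_le {α : ℝ} (hα₀ : 0 < α) (hα₁ : α < 1) {x : ℝ}
    (hx : |x| ≤ radius α) : logPotential (muAlpha α) x = logPotential (muAlpha α) 0 := by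
  rw [(logPotential_muAlpha hα₀ hα₁ x).2, (logPotential_muAlpha hα₀ hα₁ 0).2]
  refine setIntegral_congr_fun measurableSet_Ioo fun t ht => ?_
  obtain ⟨h1, -, h2, -⟩ := sqrt_one_sub_sq_bounds hα₁ ht
  simp only [arcsinePotential_of_abs_le h1 (hx.trans h2),
    arcsinePotential_of_abs_le h1 (x := 0) (by simp)]

theorem logPotential_muAlpha_le {α : ℝ} (hα₀ : 0 < α) (hα₁ : α < 1) (x : ℝ) :
    logPotential (muAlpha α) x ≤ logPotential (muAlpha α) 0 := by
  rw [(logPotential_muAlpha hα₀ hα₁ x).2, (logPotential_muAlpha hα₀ hα₁ 0).2]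
  refine setIntegral_mono_on (logPotential_muAlpha hα₀ hα₁ x).1 (logPotential_muAlpha hα₀ hα₁ 0).1
    measurableSet_Ioo fun t ht => ?_
  obtain ⟨h1, -, -, -⟩ := sqrt_one_sub_sq_bounds hα₁ ht
  rw [arcsinePotential_of_abs_le h1 (x := 0) (by simp)]
  exact arcsinePotential_le h1 x

theorem logPotential_muAlpha_one_le {α : ℝ} (hα₀ : 0 < α) (hα₁ : α < 1) {x : ℝ} (hx : |x| ≤ 1) :
    logPotential (muAlpha α) 1 ≤ logPotential (muAlpha α) x := by
  rw [(logPotential_muAlpha hα₀ hα₁ x).2, (logPotential_muAlpha hα₀ hα₁ 1).2]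
  refine setIntegral_mono_on (logPotential_muAlpha hα₀ hα₁ 1).1 (logPotential_muAlpha hα₀ hα₁ x).1
    measurableSet_Ioo fun t ht => ?_
  obtain ⟨h1, h2, -, -⟩ := sqrt_one_sub_sq_bounds hα₁ ht
  exact arcsinePotential_one_le h1 h2 hx

theorem logPotential_muAlpha_zero_sub_one {α : ℝ} (hα₀ : 0 < α) (hα₁ : α < 1) :
    logPotential (muAlpha α) 0 - logPotential (muAlpha α) 1 = C α := by
  obtain ⟨hi0, h0⟩ := logPotential_muAlpha hα₀ hα₁ 0
  obtain ⟨hi1, h1⟩ := logPotential_muAlpha hα₀ hα₁ 1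
  rw [h0, h1, ← integral_sub hi0 hi1]
  have hcongr : ∀ t ∈ Ioo 0 α, arcsinePotential (√(1 - t ^ 2)) 0 - arcsinePotential (√(1 - t ^ 2)) 1
      = (log (1 + t) - log (1 - t)) / 2 := by
    intro t ht
    obtain ⟨h1, h2, -, h3⟩ := sqrt_one_sub_sq_bounds hα₁ ht
    have ha : 0 < 1 + t := by linarith [ht.1]
    have hb : 0 < 1 - t := by linarith [ht.2]
    rw [arcsinePotential_of_abs_le h1 (x := 0) (by simp), arcsinePotential_one h1 h2, h3,
      log_div two_ne_zero h1.ne', log_div two_ne_zero ha.ne', log_sqrt (by nlinarith),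
      show 1 - t ^ 2 = (1 + t) * (1 - t) by ring, log_mul ha.ne' hb.ne']
    ring
  rw [setIntegral_congr_fun measurableSet_Ioo hcongr, ← integral_Ioc_eq_integral_Ioo,
    ← intervalIntegral.integral_of_le hα₀.le]
  -- `C` itself is the primitive, and it vanishes at `0`.
  have hderiv : ∀ t ∈ uIcc 0 α, HasDerivAt C ((log (1 + t) - log (1 - t)) / 2) t := by
    intro t ht
    rw [uIcc_of_le hα₀.le] at ht
    have ha : 1 + t ≠ 0 := by linarith [ht.1]
    have hb : 1 - t ≠ 0 := by linarith [ht.2]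
    have h1 : HasDerivAt (fun t : ℝ => 1 + t) 1 t := (hasDerivAt_id t).const_add 1
    have h2 : HasDerivAt (fun t : ℝ => 1 - t) (-1) t := (hasDerivAt_id t).const_sub 1
    refine (((h1.mul (h1.log ha)).add (h2.mul (h2.log hb))).div_const 2).congr_deriv ?_
    field_simp
    ring
  have hcont : ContinuousOn (fun t => (log (1 + t) - log (1 - t)) / 2) (uIcc 0 α) := by
    rw [uIcc_of_le hα₀.le]
    refine ContinuousOn.div_const (ContinuousOn.sub ?_ ?_) 2
    · exact ContinuousOn.log (by fun_prop) fun t ht => by linarith [ht.1]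
    · exact ContinuousOn.log (by fun_prop) fun t ht => by linarith [ht.2]
  rw [intervalIntegral.integral_eq_sub_of_hasDerivAt hderiv hcont.intervalIntegrable]
  simp [C]

/-- Adding `x - 1 < x log x` at `x = 1 + α` and `x = 1 - α` makes the linear terms cancel.
Positivity is what keeps the minimizer off the support in the equality case. -/
theorem C_pos {α : ℝ} (hα₀ : 0 < α) (hα₁ : α < 1) : 0 < C α := by
  have key : ∀ x : ℝ, 0 < x → x ≠ 1 → x - 1 < x * log x := fun x hx hx1 => by
    have h := log_lt_sub_one_of_pos (inv_pos.2 hx) (inv_ne_one.2 hx1)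
    rw [log_inv] at h
    have := mul_lt_mul_of_pos_left h hx
    rw [mul_sub, mul_inv_cancel₀ hx.ne'] at this
    linarith
  have h1 := key (1 + α) (by linarith) (by linarith)
  have h2 := key (1 - α) (by linarith) (by linarith)
  unfold C
  linarith

/-! ### The extremal problem -/

theorem continuous_logPotential {μ : Measure ℝ} (hμ : μ ≤ sigma) : Continuous (logPotential μ) := by
  have : logPotential μ = fun x : ℝ => cpot μ x := funext fun x => (cpot_ofReal μ x).symm
  rw [this]
  exact (continuous_cpot hμ).comp Complex.continuous_ofReal

theorem exists_isLeast_support {α : ℝ} (hα₁ : α < 1) {μ : Measure ℝ}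
    (hμ : μ ∈ constrainedMeasures α) :
    ∃ m, IsLeast (logPotential μ '' (sigma - μ).support) m :=
  ((isCompact_Icc.of_isClosed_subset Measure.isClosed_support
    (support_sigma_sub_subset μ)).image (continuous_logPotential hμ.2)).exists_isLeast
      ((support_sigma_sub_nonempty hα₁ hμ).image _)

theorem exists_isLeast_Icc {μ : Measure ℝ} (hμ : μ ≤ sigma) :
    ∃ m, IsLeast (logPotential μ '' Icc (-1) 1) m :=
  (isCompact_Icc.image (continuous_logPotential hμ)).exists_isLeast
    ((nonempty_Icc.2 (by norm_num)).image _)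

theorem J_eq {μ : Measure ℝ} {m n : ℝ} (hm : IsLeast (logPotential μ '' (sigma - μ).support) m)
    (hn : IsLeast (logPotential μ '' Icc (-1) 1) n) : J μ = m - n := by
  rw [J, minOver, minOver, hm.csInf_eq, hn.csInf_eq]

theorem J_muAlpha {α : ℝ} (hα₀ : 0 < α) (hα₁ : α < 1) : J (muAlpha α) = C α := by
  rw [← logPotential_muAlpha_zero_sub_one hα₀ hα₁]
  refine J_eq ?_ ?_
  · have hconst : ∀ x ∈ (sigma - muAlpha α).support,
        logPotential (muAlpha α) x = logPotential (muAlpha α) 0 := fun x hx =>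
      logPotential_muAlpha_of_abs_le hα₀ hα₁ (support_sigma_sub_muAlpha_subset hα₀ hα₁ hx)
    obtain ⟨x, hx⟩ := support_sigma_sub_nonempty hα₁ (muAlpha_mem hα₀ hα₁)
    refine ⟨⟨x, hx, hconst x hx⟩, ?_⟩
    rintro _ ⟨y, hy, rfl⟩
    exact (hconst y hy).ge
  · refine ⟨⟨1, by norm_num, rfl⟩, ?_⟩
    rintro _ ⟨y, hy, rfl⟩
    exact logPotential_muAlpha_one_le hα₀ hα₁ (abs_le.2 hy)

theorem J_lt_J_muAlpha {α : ℝ} (hα₀ : 0 < α) (hα₁ : α < 1) {μ : Measure ℝ}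
    (hμ : μ ∈ constrainedMeasures α) (hne : μ ≠ muAlpha α) : J μ < J (muAlpha α) := by
  obtain ⟨m, hm⟩ := exists_isLeast_support hα₁ hμ
  obtain ⟨n, hn⟩ := exists_isLeast_Icc hμ.2
  obtain ⟨x, hx, hxn⟩ := hn.1
  have hα := muAlpha_mem hα₀ hα₁
  have hC := logPotential_muAlpha_zero_sub_one hα₀ hα₁
  -- On the support `U^μ ≥ m`, while `U^{μ_α} ≤ U^{μ_α}(0)` everywhere; this dictates the additive
  -- constant.
  have hD : ∀ z, 0 ≤ cpot μ z - cpot (muAlpha α) z + (logPotential (muAlpha α) 0 - m) := by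
    refine nonneg_of_nonneg_on_support hμ.2 hα.2 (hμ.1.trans hα.1.symm)
      (support_sigma_sub_nonempty hα₁ hμ) fun y hy => ?_
    rw [cpot_ofReal, cpot_ofReal]
    have h1 := logPotential_muAlpha_le hα₀ hα₁ y
    have h2 := hm.2 ⟨y, hy, rfl⟩
    linarith
  have hDx := hD x
  have h1 := logPotential_muAlpha_one_le hα₀ hα₁ (abs_le.2 hx)
  rw [J_eq hm hn, J_muAlpha hα₀ hα₁]
  by_contra! hge
  have hCpos := C_pos hα₀ hα₁
  -- If `m - n ≥ C α`, then `x` in the support would give `m ≤ n`, against `C α > 0`. The same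
  -- inequality with the minimality of `U^{μ_α}` at `1` forces `D x ≤ 0`, hence `D x = 0`.
  refine hne (eq_of_zero_off_support hμ.2 hα.2 hD (x := x) (fun hxS => ?_) ?_)
  · have h2 := hm.2 ⟨x, hxS, rfl⟩
    linarith
  · rw [cpot_ofReal, cpot_ofReal] at hDx ⊢
    linarith

end GridPotential

end

theorem proposition3p3 (α : ℝ) (hα₀ : 0 < α) (hα₁ : α < 1) :
    -- for every measure in the class the potential is a convergent integral, and the two minima
    -- in the definition of `J` exist
    (∀ μ ∈ GridPotential.constrainedMeasures α,
      (∀ x : ℝ, MeasureTheory.Integrable (GridPotential.logKernel x) μ) ∧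
      (∃ m : ℝ, IsLeast
        (GridPotential.logPotential μ '' (GridPotential.sigma - μ).support) m) ∧
      (∃ m : ℝ, IsLeast
        (GridPotential.logPotential μ '' Set.Icc (-1) 1) m)) ∧
    -- `μ_α` is in the class, `J(μ_α) = C(α)`, and `J(μ) < J(μ_α)` for all other `μ`
    GridPotential.muAlpha α ∈ GridPotential.constrainedMeasures α ∧
    GridPotential.J (GridPotential.muAlpha α) = GridPotential.C α ∧
    (∀ μ ∈ GridPotential.constrainedMeasures α, μ ≠ GridPotential.muAlpha α →
      GridPotential.J μ < GridPotential.J (GridPotential.muAlpha α)) ∧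
    -- `μ_α` is the unique maximizer of `J` over the class
    (∀ μ ∈ GridPotential.constrainedMeasures α,
      (IsMaxOn GridPotential.J (GridPotential.constrainedMeasures α) μ ↔
        μ = GridPotential.muAlpha α)) := by
  have hmax := fun μ (hμ : μ ∈ GridPotential.constrainedMeasures α) hne =>
    GridPotential.J_lt_J_muAlpha hα₀ hα₁ hμ hne
  have hmem := GridPotential.muAlpha_mem hα₀ hα₁
  refine ⟨fun μ hμ => ⟨GridPotential.integrable_logKernel hμ.2,
    GridPotential.exists_isLeast_support hα₁ hμ, GridPotential.exists_isLeast_Icc hμ.2⟩, hmem,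
    GridPotential.J_muAlpha hα₀ hα₁, hmax, fun μ hμ => ⟨fun h => ?_, ?_⟩⟩
  · by_contra hne
    exact (hmax μ hμ hne).not_ge (h hmem)
  · rintro rfl ν hν
    rcases eq_or_ne ν (GridPotential.muAlpha α) with h | hne
    · exact (congrArg GridPotential.J h).le
    · exact (hmax ν hν hne).le
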